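/- Let $N,m\in\mathbb N=\{1,2,\dots\}$ and $s\in(0,m)$. For $u:\mathbb R^N\to\mathbb C$ and $x,y\in\mathbb R^N$ put $$\delta_m u(x,y)=\sum_{k=-m}^{m}(-1)^k\binom{2m}{m-k}u(x+ky),$$ and let $$L_{m,s}u(x)=\frac{c_{N,m,s}}{2}\int_{\mathbb R^N}\frac{\delta_m u(x,y)}{|y|^{N+2s}}\,dy,$$ where $$c_{N,m,s}=\begin{cases}\dfrac{4^{s}\,\Gamma(\frac N2+s)}{\pi^{N/2}\,\Gamma(-s)}\Big(\sum_{k=1}^{m}(-1)^{k}\binom{2m}{m-k}k^{2s}\Big)^{-1}, & s\in(0,m)\setminus\mathbb N,\\[3mm] \dfrac{4^{s}\,\Gamma(\frac N2+s)\,s!}{2\pi^{N/2}}\Big(\sum_{k=2}^{m}(-1)^{k-s+1}\binom{2m}{m-k}k^{2s}\ln k\Big)^{-1}, & s\in\{1,\dots,m-1\}.\end{cases}$$ Let $$\mathcal F u(\xi)=(2\pi)^{-N/2}\int_{\mathbb R^N}e^{-i x\cdot\xi}u(x)\,dx,\qquad \mathcal F^{-1}g(x)=(2\pi)^{-N/2}\int_{\mathbb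 R^N}e^{i x\cdot\xi}g(\xi)\,d\xi .$$ Then, for every $u\in C_c^\infty(\mathbb R^N)$ (the complex-valued smooth functions with compact support), the integral defining $L_{m,s}u(x)$ converges absolutely for every $x\in\mathbb R^N$, $L_{m,s}u\in L^2(\mathbb R^N)$, the function $\xi\mapsto|\xi|^{2s}\mathcal F u(\xi)$ belongs to $L^1(\mathbb R^N)\cap L^2(\mathbb R^N)$, and $$L_{m,s}u(x)=\mathcal F^{-1}\big(|\cdot|^{2s}\mathcal F u\big)(x)\qquad\text{for every }x\in\mathbb R^N .$$ -/

import Mathlib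

open scoped ContDiff

noncomputable section

namespace Hypersingular

/-- `ℝ^N` with its Euclidean norm and Lebesgue measure. -/
abbrev Space (N : ℕ) : Type := EuclideanSpace ℝ (Fin N)

/-- The normalizing constant `c_{N,m,s}`, with one formula for natural numbers `s`
(where `s = ⌊s⌋₊`) and another one for the other values of `s`. -/
def normConst (N m : ℕ) (s : ℝ) : ℝ :=
  if s = (⌊s⌋₊ : ℝ) then
    (4 : ℝ) ^ s * Real.Gamma ((N : ℝ) / 2 + s) * (Nat.factorial ⌊s⌋₊ : ℝ)
        / (2 * Real.pi ^ ((N : ℝ) / 2)) *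
      (∑ k ∈ Finset.Icc 2 m, (-1 : ℝ) ^ ((k : ℤ) - (⌊s⌋₊ : ℤ) + 1) *
        (Nat.choose (2 * m) (m - k) : ℝ) * (k : ℝ) ^ (2 * s) * Real.log (k : ℝ))⁻¹
  else
    (4 : ℝ) ^ s * Real.Gamma ((N : ℝ) / 2 + s)
        / (Real.pi ^ ((N : ℝ) / 2) * Real.Gamma (-s)) *
      (∑ k ∈ Finset.Icc 1 m, (-1 : ℝ) ^ k *
        (Nat.choose (2 * m) (m - k) : ℝ) * (k : ℝ) ^ (2 * s))⁻¹

/-- The centered finite difference of order `2m`,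
`δ_m u(x,y) = ∑_{k=-m}^{m} (-1)^k (2m choose m-k) u(x + k y)`. -/
def finDiff {N : ℕ} (m : ℕ) (u : Space N → ℂ) (x y : Space N) : ℂ :=
  ∑ k ∈ Finset.Icc (-(m : ℤ)) (m : ℤ),
    (-1 : ℂ) ^ k * (Nat.choose (2 * m) ((m : ℤ) - k).toNat : ℂ) * u (x + (k : ℝ) • y)

/-- The integrand `y ↦ δ_m u(x,y) / |y|^{N+2s}`. -/
def integrand {N : ℕ} (m : ℕ) (s : ℝ) (u : Space N → ℂ) (x y : Space N) : ℂ :=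
  finDiff m u x y / ((‖y‖ ^ ((N : ℝ) + 2 * s) : ℝ) : ℂ)

/-- The hypersingular integral
`L_{m,s} u(x) = (c_{N,m,s} / 2) ∫ δ_m u(x,y) / |y|^{N+2s} dy`. -/
def hyperL {N : ℕ} (m : ℕ) (s : ℝ) (u : Space N → ℂ) (x : Space N) : ℂ :=
  ((normConst N m s / 2 : ℝ) : ℂ) * ∫ y, integrand m s u x y

/-- The Fourier transform in the angular frequency variable,
`F u(ξ) = (2π)^{-N/2} ∫ e^{-i x·ξ} u(x) dx`. -/
def fourierF {N : ℕ} (u : Space N → ℂ) (ξ : Space N) : ℂ :=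
  (((2 * Real.pi) ^ (-((N : ℝ) / 2)) : ℝ) : ℂ) *
    ∫ x, Complex.exp (-(Complex.I * ((inner ℝ x ξ : ℝ) : ℂ))) * u x

/-- The inverse Fourier transform, `F⁻¹ g(x) = (2π)^{-N/2} ∫ e^{i x·ξ} g(ξ) dξ`. -/
def fourierFInv {N : ℕ} (g : Space N → ℂ) (x : Space N) : ℂ :=
  (((2 * Real.pi) ^ (-((N : ℝ) / 2)) : ℝ) : ℂ) *
    ∫ ξ, Complex.exp (Complex.I * ((inner ℝ x ξ : ℝ) : ℂ)) * g ξ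

/-- The function `ξ ↦ |ξ|^{2s} F u(ξ)`. -/
def symbolMul {N : ℕ} (s : ℝ) (u : Space N → ℂ) (ξ : Space N) : ℂ :=
  ((‖ξ‖ ^ (2 * s) : ℝ) : ℂ) * fourierF u ξ

end Hypersingular

end

/-! By Fourier inversion, $\delta_m u(x,y)$ is the inverse transform of
$(2-2\cos(y\cdot\xi))^m\,\mathcal F u(\xi)$ (`finDiff_eq_integral`). This symbol is nonnegative, so
everything reduces to its integral $I(\xi)$ against $|y|^{-N-2s}$ and to one use of Fubini.

To compute $I(\xi)$, write the kernel as a Mellin superposition of Gaussians $e^{-|y|^2/4\tau}$. The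
Gaussian mean of the symbol is, up to a power of $\tau$, the exponential sum $\sum_k w_k
e^{-k^2|\xi|^2\tau}$ with signed binomial weights $w_k$, so `integral_diffSymbol_div` turns $I(\xi)$
into a Mellin transform of that sum at $-s$. The first $m$ moments of the sum vanish, which permits
integration by parts until the exponent can be handled directly: a Gamma integral for non-integer
$s$ (`integral_rpow_mul_expSum_of_mem_Ioo`), a Frullani integral, hence logarithms, for integer $s$
(`integral_rpow_mul_expSum_natCast`). These are the two cases of the constant. Positivity of
$I(\xi)$ shows that the sums inverted there are nonzero.

Membership of $L_{m,s}u$ in $L^2$ does not go through Plancherel: the function is bounded, as the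
inverse transform of an $L^1$ function, and it is integrable because $\int|\delta_m
u(x,y)|\,dx\lesssim\min(1,|y|^{2m})$. -/

namespace Hypersingular

/-! ### Algebra of the difference weights. -/

/-- The signed binomial weights of the centered difference of order `2m`. -/
noncomputable def diffWeight (m : ℕ) (k : ℤ) : ℝ :=
  (-1 : ℝ) ^ k * (Nat.choose (2 * m) ((m : ℤ) - k).toNat : ℝ)

/-- The shift $k=j-m$ brings the symmetric sum to the form of the binomial theorem and of iterated
forward differences. -/
theorem sum_diffWeight_mul {R : Type*} [Ring R] [Module ℝ R] (m : ℕ) (f : ℤ → R) :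
    ∑ k ∈ Finset.Icc (-(m : ℤ)) m, diffWeight m k • f k =
      ∑ j ∈ Finset.range (2 * m + 1),
        ((-1 : ℝ) ^ m * ((-1 : ℝ) ^ j * (Nat.choose (2 * m) j : ℝ))) • f ((j : ℤ) - m) := by
  symm
  refine Finset.sum_bij (fun j _ => (j : ℤ) - m) ?_ ?_ ?_ ?_
  · intro j hj
    simp only [Finset.mem_range, Finset.mem_Icc] at *
    omega
  · intro a _ b _ h
    simpa using h
  · intro b hb
    simp only [Finset.mem_range, Finset.mem_Icc] at *
    exact ⟨(b + m).toNat, by omega, by omega⟩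
  · intro j hj
    simp only [Finset.mem_range] at hj
    have h1 : ((m : ℤ) - ((j : ℤ) - m)).toNat = 2 * m - j := by omega
    have h2 : (-1 : ℝ) ^ ((j : ℤ) - m) = (-1) ^ m * (-1) ^ j := by
      rw [zpow_sub₀ (by norm_num), zpow_natCast, zpow_natCast, div_eq_mul_inv, ← inv_pow,
        mul_comm]
      norm_num
    rw [diffWeight, h1, h2, Nat.choose_symm (by omega), mul_assoc]

/-- Up to sign this is the $2m$-th forward difference of $x^j$ at $-m$, which kills degrees below
$2m$. -/
theorem sum_diffWeight_mul_pow (m j : ℕ) (hj : j < 2 * m) :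
    ∑ k ∈ Finset.Icc (-(m : ℤ)) m, diffWeight m k * (k : ℝ) ^ j = 0 := by
  have h := sum_diffWeight_mul m (fun k => (k : ℝ) ^ j)
  simp only [smul_eq_mul] at h
  rw [h]
  have h2 := congrFun (fwdDiff_iter_pow_eq_zero_of_lt (R := ℝ) hj) (-(m : ℝ))
  rw [fwdDiff_iter_eq_sum_shift] at h2
  simp only [Pi.zero_apply, zsmul_eq_mul] at h2
  rw [← mul_zero ((-1 : ℝ) ^ m), ← h2, Finset.mul_sum]
  refine Finset.sum_congr rfl fun i hi => ?_
  have hi' : i ≤ 2 * m := by simpa [Nat.lt_succ_iff] using hi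
  have : (-1 : ℝ) ^ (2 * m - i) = (-1) ^ i := by
    rw [neg_one_pow_eq_pow_mod_two, neg_one_pow_eq_pow_mod_two (n := i)]
    congr 1
    omega
  push_cast
  rw [this]
  simp only [nsmul_eq_mul, mul_one]
  ring

/-- With $z=e^{i\theta}$, the sum is $(-z^{-1})^m(1-z)^{2m}$, and $2-2\cos\theta=-z^{-1}(1-z)^2$. -/
theorem sum_diffWeight_mul_exp (m : ℕ) (θ : ℝ) :
    ∑ k ∈ Finset.Icc (-(m : ℤ)) m,
      (diffWeight m k : ℂ) * Complex.exp (Complex.I * ((k : ℝ) * θ : ℝ)) =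
      (((2 - 2 * Real.cos θ) ^ m : ℝ) : ℂ) := by
  have h := sum_diffWeight_mul m (fun k => Complex.exp (Complex.I * ((k : ℝ) * θ : ℝ)))
  simp only [Complex.real_smul] at h
  rw [h]
  set z := Complex.exp (Complex.I * θ) with hz
  have hz0 : z ≠ 0 := Complex.exp_ne_zero _
  have hzk : ∀ j : ℕ, Complex.exp (Complex.I * (((((j : ℤ) - m : ℤ) : ℝ) * θ : ℝ) : ℂ)) =
      z ^ j * (z⁻¹) ^ m := by
    intro j
    rw [hz, ← Complex.exp_neg, ← Complex.exp_nat_mul, ← Complex.exp_nat_mul, ← Complex.exp_add]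
    congr 1
    push_cast
    ring
  have hb : (1 - z) ^ (2 * m) = ∑ j ∈ Finset.range (2 * m + 1),
      (-1 : ℂ) ^ j * (Nat.choose (2 * m) j : ℂ) * z ^ j := by
    rw [sub_eq_neg_add, add_pow]
    refine Finset.sum_congr rfl fun j _ => ?_
    rw [neg_pow]
    ring
  have hc : ((2 - 2 * Real.cos θ : ℝ) : ℂ) = -1 * z⁻¹ * (1 - z) ^ 2 := by
    have : (Real.cos θ : ℂ) = (z + z⁻¹) / 2 := by
      rw [Complex.ofReal_cos, Complex.cos, hz, ← Complex.exp_neg]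
      congr 2 <;> ring_nf
    push_cast at this ⊢
    rw [this]
    field_simp
    ring
  rw [Complex.ofReal_pow, hc, mul_pow, mul_pow, ← pow_mul, hb, Finset.mul_sum]
  refine Finset.sum_congr rfl fun j _ => ?_
  rw [hzk]
  push_cast
  ring

theorem sum_diffWeight_mul_even (m : ℕ) (f : ℝ → ℝ) (hf : ∀ x, f (-x) = f x) (h0 : f 0 = 0) :
    ∑ k ∈ Finset.Icc (-(m : ℤ)) m, diffWeight m k * f k =
      2 * ∑ k ∈ Finset.Icc 1 m, (-1 : ℝ) ^ k * (Nat.choose (2 * m) (m - k) : ℝ) * f k := by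
  set F : ℤ → ℝ := fun k => diffWeight m k * f k
  have hpos : ∀ n : ℕ, n ≤ m → F n = (-1 : ℝ) ^ n * (Nat.choose (2 * m) (m - n) : ℝ) * f n := by
    intro n hn
    have : ((m : ℤ) - n).toNat = m - n := by omega
    simp [F, diffWeight, this]
  have hneg : ∀ n : ℕ, n ≤ m → F (-n) = F n := by
    intro n hn
    have h1 : ((m : ℤ) - n).toNat = m - n := by omega
    have h2 : ((m : ℤ) - -n).toNat = m + n := by omega
    have h3 : Nat.choose (2 * m) (m + n) = Nat.choose (2 * m) (m - n) :=
      Nat.choose_symm_of_eq_add (by omega)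
    have h4 : (-1 : ℝ) ^ (-(n : ℤ)) = (-1) ^ (n : ℤ) := by
      rw [zpow_neg, ← inv_zpow]
      norm_num
    change diffWeight m (-n) * f ((-(n : ℤ) : ℤ) : ℝ) = diffWeight m n * f ((n : ℤ) : ℝ)
    rw [diffWeight, diffWeight, h1, h2, h3, h4, Int.cast_neg, hf]
  -- The range grows with `M` while the binomial coefficients keep the fixed `m`, so that the
  -- induction closes.
  have key : ∀ M : ℕ, M ≤ m → ∑ k ∈ Finset.Icc (-(M : ℤ)) M, F k =
      2 * ∑ k ∈ Finset.Icc 1 M, (-1 : ℝ) ^ k * (Nat.choose (2 * m) (m - k) : ℝ) * f k := by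
    intro M
    induction M with
    | zero => intro _; simp [F, h0]
    | succ n ih =>
      intro hn
      have hset : Finset.Icc (-((n + 1 : ℕ) : ℤ)) ((n + 1 : ℕ) : ℤ) =
          insert (-((n + 1 : ℕ) : ℤ)) (insert ((n + 1 : ℕ) : ℤ) (Finset.Icc (-(n : ℤ)) n)) := by
        ext k
        simp only [Finset.mem_Icc, Finset.mem_insert]
        omega
      rw [hset, Finset.sum_insert, Finset.sum_insert, ih (by omega), hneg _ hn, hpos _ hn,
        Finset.sum_Icc_succ_top (by omega)]
      · ring
      · simp
      · simp only [Finset.mem_Icc, Finset.mem_insert]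
        omega
  exact key m le_rfl

/-! ### Mellin transforms of exponential sums. -/

open Filter Topology Asymptotics MeasureTheory Set

/-- A finite sum of decaying exponentials `∑ b_i e^{-l_i τ}`. -/
noncomputable def expSum {ι : Type*} (t : Finset ι) (b l : ι → ℝ) (τ : ℝ) : ℝ :=
  ∑ i ∈ t, b i * Real.exp (-(l i * τ))

section expSum

variable {ι : Type*} {t : Finset ι} {b l : ι → ℝ}

theorem continuous_expSum : Continuous (expSum t b l) := by
  unfold expSum
  fun_prop

theorem hasDerivAt_expSum (τ : ℝ) :
    HasDerivAt (expSum t b l) (expSum t (fun i => -(l i * b i)) l τ) τ := by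
  unfold expSum
  refine HasDerivAt.fun_sum fun i _ => ?_
  have h := (((hasDerivAt_id τ).const_mul (l i)).neg.exp).const_mul (b i)
  refine h.congr_deriv ?_
  simp
  ring

/-- The vanishing moments cancel every Taylor term of degree below `M`, leaving only the remainders.
-/
theorem expSum_isBigO_zero {M : ℕ} (hM : ∀ j < M, ∑ i ∈ t, b i * l i ^ j = 0) :
    expSum t b l =O[𝓝 0] fun τ => τ ^ M := by
  have h1 : ∀ i, (fun τ => Real.exp (-(l i * τ)) -
      ∑ j ∈ Finset.range M, (-(l i * τ)) ^ j / (Nat.factorial j : ℝ)) =O[𝓝 0] fun τ => τ ^ M := by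
    intro i
    have ht : Tendsto (fun τ : ℝ => -(l i * τ)) (𝓝 0) (𝓝 0) := by
      refine Continuous.tendsto' (by fun_prop) _ _ (by simp)
    refine ((Real.exp_sub_sum_range_isBigO_pow M).comp_tendsto ht).trans ?_
    refine IsBigO.of_bound (|l i| ^ M) (Eventually.of_forall fun τ => ?_)
    simp [mul_pow]
  have h2 : expSum t b l = fun τ => ∑ i ∈ t, b i * (Real.exp (-(l i * τ)) -
      ∑ j ∈ Finset.range M, (-(l i * τ)) ^ j / (Nat.factorial j : ℝ)) := by
    ext τ
    simp only [mul_sub, Finset.sum_sub_distrib, Finset.mul_sum]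
    rw [Finset.sum_comm]
    have : ∀ j ∈ Finset.range M, ∑ i ∈ t, b i * ((-(l i * τ)) ^ j / (Nat.factorial j : ℝ)) = 0 := by
      intro j hj
      rw [← mul_zero ((-τ) ^ j / (Nat.factorial j : ℝ)), ← hM j (Finset.mem_range.1 hj),
        Finset.mul_sum]
      refine Finset.sum_congr rfl fun i _ => ?_
      rw [← mul_neg, mul_pow]
      ring
    rw [Finset.sum_eq_zero this, sub_zero, expSum]
  rw [h2]
  exact IsBigO.fun_sum fun i _ => (h1 i).const_mul_left _

theorem expSum_isBigO_one (hl : ∀ i ∈ t, 0 ≤ l i) :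
    expSum t b l =O[atTop] fun τ : ℝ => τ ^ (-(0 : ℝ)) := by
  refine IsBigO.fun_sum fun i hi => IsBigO.const_mul_left ?_ _
  refine IsBigO.of_bound 1 ?_
  filter_upwards [eventually_ge_atTop 0] with τ hτ
  have : 0 ≤ l i * τ := mul_nonneg (hl i hi) hτ
  simpa using this

/-- Without a constant term the decay is exponential; the rate $1/\tau$ is all that the Mellin
integral needs after one differentiation, where the exponent exceeds $-1$. -/
theorem expSum_isBigO_inv (hl : ∀ i ∈ t, 0 ≤ l i) (hb : ∀ i ∈ t, l i = 0 → b i = 0) :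
    expSum t b l =O[atTop] fun τ : ℝ => τ ^ (-(1 : ℝ)) := by
  refine IsBigO.fun_sum fun i hi => ?_
  rcases (hl i hi).eq_or_lt with h | h
  · simp [hb i hi h.symm, isBigO_zero]
  refine IsBigO.const_mul_left (IsBigO.of_bound (l i)⁻¹ ?_) _
  filter_upwards [eventually_gt_atTop 0] with τ hτ
  rw [Real.rpow_neg hτ.le, Real.rpow_one, norm_inv, Real.norm_of_nonneg hτ.le,
    Real.norm_of_nonneg (Real.exp_pos _).le, ← mul_inv, Real.exp_neg]
  have hp : 0 < l i * τ := mul_pos h hτ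
  exact inv_anti₀ hp (by linarith [Real.add_one_le_exp (l i * τ)])

theorem integrableOn_rpow_mul_expSum {M : ℕ} (hM : ∀ j < M, ∑ i ∈ t, b i * l i ^ j = 0)
    {a s : ℝ} (ha : expSum t b l =O[atTop] fun τ : ℝ => τ ^ (-a)) (has : -s < a) (hs : s < M) :
    IntegrableOn (fun τ : ℝ => τ ^ (-s - 1) * expSum t b l τ) (Ioi 0) := by
  refine mellin_convergent_of_isBigO_scalar (a := a) (b := -M) (s := -s)
    (continuous_expSum.locallyIntegrable.locallyIntegrableOn _) ha has ?_ (by linarith)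
  refine ((expSum_isBigO_zero hM).mono nhdsWithin_le_nhds).congr_right fun τ => ?_
  simp

theorem integrableOn_rpow_mul_expSum_of_pos (hl : ∀ i ∈ t, 0 ≤ l i) {M : ℕ}
    (hM : ∀ j < M, ∑ i ∈ t, b i * l i ^ j = 0) {s : ℝ} (hs0 : 0 < s) (hs : s < M) :
    IntegrableOn (fun τ : ℝ => τ ^ (-s - 1) * expSum t b l τ) (Ioi 0) :=
  integrableOn_rpow_mul_expSum hM (expSum_isBigO_one hl) (by linarith) hs

theorem sum_neg_mul_mul_pow {M : ℕ} (hM : ∀ j < M + 1, ∑ i ∈ t, b i * l i ^ j = 0) :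
    ∀ j < M, ∑ i ∈ t, -(l i * b i) * l i ^ j = 0 := by
  intro j hj
  rw [← neg_zero, ← hM (j + 1) (by omega), ← Finset.sum_neg_distrib]
  exact Finset.sum_congr rfl fun i _ => by ring

/-- Integration by parts trades $s$ for $s-1$ and costs one moment. The boundary terms vanish, being
$O(\tau^{M+1-s})$ at $0$ and $O(\tau^{-s})$ at infinity; differentiation also removes the terms with
$l_i=0$. -/
theorem integral_rpow_mul_expSum_step (hl : ∀ i ∈ t, 0 ≤ l i) {M : ℕ}
    (hM : ∀ j < M + 1, ∑ i ∈ t, b i * l i ^ j = 0) {s : ℝ} (hs0 : 0 < s) (hs : s < M + 1) :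
    ∫ τ in Ioi (0 : ℝ), τ ^ (-s - 1) * expSum t b l τ =
      s⁻¹ * ∫ τ in Ioi (0 : ℝ), τ ^ (-(s - 1) - 1) * expSum t (fun i => -(l i * b i)) l τ := by
  have hI1 := integrableOn_rpow_mul_expSum_of_pos hl hM hs0 (by exact_mod_cast hs)
  have hI2 : IntegrableOn
      (fun τ : ℝ => τ ^ (-(s - 1) - 1) * expSum t (fun i => -(l i * b i)) l τ) (Ioi 0) :=
    integrableOn_rpow_mul_expSum (sum_neg_mul_mul_pow hM)
      (expSum_isBigO_inv hl fun i _ h => by simp [h]) (by linarith) (by linarith)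
  have hexp : ∀ τ : ℝ, τ ^ (-(s - 1) - 1) = τ ^ (-s) := fun τ => by congr 1; ring
  simp only [hexp] at hI2 ⊢
  have hu : ∀ x ∈ Ioi (0 : ℝ), HasDerivAt (fun τ : ℝ => τ ^ (-s)) (-s * x ^ (-s - 1)) x :=
    fun x hx => Real.hasDerivAt_rpow_const (Or.inl (mem_Ioi.1 hx).ne')
  have h0 : Tendsto ((fun τ : ℝ => τ ^ (-s)) * expSum t b l) (𝓝[>] 0) (𝓝 0) := by
    have h1 : (expSum t b l) =O[𝓝[>] 0] fun τ => τ ^ (M + 1) :=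
      (expSum_isBigO_zero hM).mono nhdsWithin_le_nhds
    have h2 := (isBigO_refl (fun τ : ℝ => τ ^ (-s)) (𝓝[>] 0)).mul h1
    refine h2.trans_tendsto ?_
    have h3 : Tendsto (fun τ : ℝ => τ ^ ((M : ℝ) + 1 - s)) (𝓝[>] 0) (𝓝 0) := by
      have := (Real.continuousAt_rpow_const 0 ((M : ℝ) + 1 - s) (Or.inr (by linarith))).tendsto
      rw [Real.zero_rpow (by linarith)] at this
      exact this.mono_left nhdsWithin_le_nhds
    refine h3.congr' ?_
    filter_upwards [self_mem_nhdsWithin] with τ hτ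
    rw [← Real.rpow_natCast, ← Real.rpow_add hτ]
    congr 1
    push_cast
    ring
  have hinf : Tendsto ((fun τ : ℝ => τ ^ (-s)) * expSum t b l) atTop (𝓝 0) := by
    have h2 := (isBigO_refl (fun τ : ℝ => τ ^ (-s)) atTop).mul (expSum_isBigO_one (b := b) hl)
    refine h2.trans_tendsto ?_
    simpa using tendsto_rpow_neg_atTop hs0
  have hI1' : IntegrableOn ((fun x : ℝ => -s * x ^ (-s - 1)) * expSum t b l) (Ioi 0) := by
    refine IntegrableOn.congr_fun (hI1.const_mul (-s)) (fun x _ => ?_) measurableSet_Ioi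
    simp [mul_assoc]
  have hibp := integral_Ioi_mul_deriv_eq_deriv_mul hu (fun x _ => hasDerivAt_expSum x)
    hI2 hI1' h0 hinf
  rw [hibp]
  simp only [mul_assoc, integral_const_mul]
  field_simp
  ring

theorem integral_rpow_mul_expSum_of_neg (hl : ∀ i ∈ t, 0 ≤ l i)
    (hb : ∀ i ∈ t, l i = 0 → b i = 0) {s : ℝ} (hs : s < 0) :
    ∫ τ in Ioi (0 : ℝ), τ ^ (-s - 1) * expSum t b l τ =
      Real.Gamma (-s) * ∑ i ∈ t, b i * l i ^ s := by
  simp only [expSum, Finset.mul_sum]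
  have hI : ∀ i ∈ t, 0 < l i →
      ∫ τ in Ioi (0 : ℝ), τ ^ (-s - 1) * Real.exp (-(l i * τ)) = l i ^ s * Real.Gamma (-s) := by
    intro i _ h
    rw [Real.integral_rpow_mul_exp_neg_mul_Ioi (by linarith) h, one_div, Real.inv_rpow h.le,
      ← Real.rpow_neg h.le, neg_neg]
  rw [integral_finsetSum]
  · refine Finset.sum_congr rfl fun i hi => ?_
    rcases (hl i hi).eq_or_lt with h | h
    · simp [hb i hi h.symm]
    · simp only [mul_left_comm _ (b i), integral_const_mul]
      rw [hI i hi h]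
      ring
  · intro i hi
    rcases (hl i hi).eq_or_lt with h | h
    · simp [hb i hi h.symm]
    · simp only [mul_left_comm _ (b i)]
      refine Integrable.const_mul ?_ _
      -- Integrability comes from the value: a non-integrable function has integral $0$ by
      -- convention, but the Gamma value is positive.
      by_contra hcon
      have h1 := hI i hi h
      rw [integral_undef hcon] at h1
      have : 0 < l i ^ s * Real.Gamma (-s) :=
        mul_pos (Real.rpow_pos_of_pos h _) (Real.Gamma_pos_of_pos (by linarith))
      linarith

/-- After $n+1$ integrations by parts $s$ lies in $(-1,0)$, where the Gamma integral applies
termwise; the functional equation of $\Gamma$ absorbs the factors $s^{-1}$. -/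
theorem integral_rpow_mul_expSum_of_mem_Ioo (n : ℕ) : ∀ {b : ι → ℝ},
    (∀ i ∈ t, 0 ≤ l i) → (∀ j < n + 1, ∑ i ∈ t, b i * l i ^ j = 0) →
    ∀ {s : ℝ}, (n : ℝ) < s → s < n + 1 →
    ∫ τ in Ioi (0 : ℝ), τ ^ (-s - 1) * expSum t b l τ =
      Real.Gamma (-s) * ∑ i ∈ t, b i * l i ^ s := by
  have aux : ∀ (b : ι → ℝ), (∀ i ∈ t, 0 ≤ l i) → ∀ s : ℝ, 0 < s → s ≠ 1 →
      s⁻¹ * (Real.Gamma (-(s - 1)) * ∑ i ∈ t, -(l i * b i) * l i ^ (s - 1)) =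
      Real.Gamma (-s) * ∑ i ∈ t, b i * l i ^ s := by
    intro b hl s hs hs1
    have h1 : Real.Gamma (-(s - 1)) = -s * Real.Gamma (-s) := by
      rw [← Real.Gamma_add_one (by linarith)]
      congr 1
      ring
    have h2 : ∑ i ∈ t, -(l i * b i) * l i ^ (s - 1) = -∑ i ∈ t, b i * l i ^ s := by
      rw [← Finset.sum_neg_distrib]
      refine Finset.sum_congr rfl fun i hi => ?_
      rcases (hl i hi).eq_or_lt with h | h
      · rw [← h, Real.zero_rpow hs.ne']
        simp
      · rw [Real.rpow_sub_one h.ne']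
        field_simp
    rw [h1, h2]
    field_simp
  induction n with
  | zero =>
    intro b hl hM s hs0 hs1
    norm_num at hs0 hs1
    rw [integral_rpow_mul_expSum_step (M := 0) hl hM hs0 (by simpa using hs1),
      integral_rpow_mul_expSum_of_neg hl (fun i _ h => by simp [h]) (by linarith)]
    exact aux b hl s hs0 hs1.ne
  | succ n ih =>
    intro b hl hM s hs0 hs1
    push_cast at hs0 hs1
    have hn : (0 : ℝ) ≤ n := n.cast_nonneg
    rw [integral_rpow_mul_expSum_step (M := n + 1) hl hM (by linarith) (by push_cast; linarith),
      ih hl (sum_neg_mul_mul_pow hM) (by linarith) (by linarith)]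
    exact aux b hl s (by linarith) (by linarith)

theorem integrableOn_inv_mul_exp_sub_exp {a : ℝ} (ha : 0 < a) :
    IntegrableOn (fun τ : ℝ => τ⁻¹ * (Real.exp (-(a * τ)) - Real.exp (-(1 * τ)))) (Ioi 0) := by
  have h := integrableOn_rpow_mul_expSum (t := Finset.univ) (b := ![1, -1]) (l := ![a, 1])
    (M := 1) (a := 1) (s := 0) (by simp) (expSum_isBigO_inv (by simp [Fin.forall_fin_two, ha.le])
      (by simp [Fin.forall_fin_two, ha.ne'])) (by norm_num) (by norm_num)
  refine IntegrableOn.congr_fun h (fun τ _ => ?_) measurableSet_Ioi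
  simp [expSum, Real.rpow_neg_one, sub_eq_add_neg]

theorem integral_inv_mul_exp_sub_exp {a : ℝ} (ha : 0 < a) :
    ∫ τ in Ioi (0 : ℝ), τ⁻¹ * (Real.exp (-(a * τ)) - Real.exp (-(1 * τ))) = -Real.log a := by
  have h := Frullani.integral_Ioi_eq (f := fun x : ℝ => Real.exp (-x)) (L := 1) (R := 0) (a := a)
    (b := 1) ((Real.continuous_exp.comp continuous_neg).locallyIntegrable.locallyIntegrableOn _) ha one_pos
    ?_ (Real.tendsto_exp_neg_atTop_nhds_zero) (integrableOn_inv_mul_exp_sub_exp ha)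
  · simpa using h
  · refine Tendsto.mono_left ?_ nhdsWithin_le_nhds
    exact Continuous.tendsto' (by fun_prop) _ _ (by simp)

/-- Since the coefficients sum to zero, $e^{-\tau}$ can be subtracted from each exponential, and
each term becomes a Frullani integral. -/
theorem integral_inv_mul_expSum (hl : ∀ i ∈ t, 0 ≤ l i) (hb : ∀ i ∈ t, l i = 0 → b i = 0)
    (hsum : ∑ i ∈ t, b i = 0) :
    ∫ τ in Ioi (0 : ℝ), τ⁻¹ * expSum t b l τ = -∑ i ∈ t, b i * Real.log (l i) := by
  have h1 : ∀ τ : ℝ, τ⁻¹ * expSum t b l τ =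
      ∑ i ∈ t, b i * (τ⁻¹ * (Real.exp (-(l i * τ)) - Real.exp (-(1 * τ)))) := by
    intro τ
    have : ∑ i ∈ t, b i * (τ⁻¹ * Real.exp (-(1 * τ))) = 0 := by
      rw [← Finset.sum_mul, hsum, zero_mul]
    simp only [mul_sub, Finset.sum_sub_distrib, this, sub_zero, expSum, Finset.mul_sum]
    exact Finset.sum_congr rfl fun i _ => by ring
  simp only [h1]
  rw [integral_finsetSum, ← Finset.sum_neg_distrib]
  · refine Finset.sum_congr rfl fun i hi => ?_
    rw [integral_const_mul]
    rcases (hl i hi).eq_or_lt with h | h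
    · simp [hb i hi h.symm]
    · rw [integral_inv_mul_exp_sub_exp h]
      ring
  · intro i hi
    rcases (hl i hi).eq_or_lt with h | h
    · simp [hb i hi h.symm]
    · exact (integrableOn_inv_mul_exp_sub_exp h).const_mul _

/-- Here $n+1$ steps end at $s=0$, a pole of $\Gamma$, so Frullani takes over. The extra vanishing
moment, of order $n+1$, becomes the zero coefficient sum needed there. -/
theorem integral_rpow_mul_expSum_natCast (n : ℕ) : ∀ {b : ι → ℝ},
    (∀ i ∈ t, 0 ≤ l i) → (∀ j < n + 2, ∑ i ∈ t, b i * l i ^ j = 0) →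
    ∫ τ in Ioi (0 : ℝ), τ ^ (-((n + 1 : ℕ) : ℝ) - 1) * expSum t b l τ =
      (-1) ^ n / (Nat.factorial (n + 1) : ℝ) *
        ∑ i ∈ t, b i * l i ^ (n + 1) * Real.log (l i) := by
  induction n with
  | zero =>
    intro b hl hM
    rw [integral_rpow_mul_expSum_step (M := 1) hl hM (by simp) (by norm_num)]
    have h := integral_inv_mul_expSum hl (b := fun i => -(l i * b i)) (fun i _ h => by simp [h])
      (by simpa using sum_neg_mul_mul_pow hM 0 (by norm_num))
    have h2 : ∀ τ : ℝ, τ ^ (-(((0 + 1 : ℕ) : ℝ) - 1) - 1) = τ⁻¹ := by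
      intro τ
      rw [← Real.rpow_neg_one]
      norm_num
    simp only [h2]
    rw [h, ← Finset.sum_neg_distrib]
    simp
    exact Finset.sum_congr rfl fun i _ => by ring
  | succ n ih =>
    intro b hl hM
    rw [integral_rpow_mul_expSum_step (M := n + 2) hl hM (by positivity) (by push_cast; linarith)]
    have h2 : ((n + 1 + 1 : ℕ) : ℝ) - 1 = ((n + 1 : ℕ) : ℝ) := by push_cast; ring
    rw [h2, ih hl (sum_neg_mul_mul_pow hM)]
    have h3 : ∑ i ∈ t, -(l i * b i) * l i ^ (n + 1) * Real.log (l i) =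
        -∑ i ∈ t, b i * l i ^ (n + 1 + 1) * Real.log (l i) := by
      rw [← Finset.sum_neg_distrib]
      exact Finset.sum_congr rfl fun i _ => by ring
    rw [h3, Nat.factorial_succ (n + 1)]
    push_cast
    field_simp
    ring

end expSum

/-! ### Gaussian superposition and the normalizing constant. -/

theorem integral_rpow_mul_exp_neg_div {p r : ℝ} (hp : 0 < p) (hr : 0 < r) :
    ∫ τ in Ioi (0 : ℝ), τ ^ (-p - 1) * Real.exp (-(r ^ 2 / (4 * τ))) =
      Real.Gamma p * 4 ^ p / r ^ (2 * p) := by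
  have h1 := Real.integral_rpow_mul_exp_neg_mul_Ioi (a := p) (r := r ^ 2 / 4) hp (by positivity)
  -- The substitution $\tau\mapsto\tau^{-1}$ in the Gamma integral.
  rw [← integral_comp_rpow_Ioi _ (p := -1) (by norm_num)] at h1
  have h2 : ∫ τ in Ioi (0 : ℝ), τ ^ (-p - 1) * Real.exp (-(r ^ 2 / (4 * τ))) =
      (1 / (r ^ 2 / 4)) ^ p * Real.Gamma p := by
    rw [← h1]
    refine setIntegral_congr_fun measurableSet_Ioi fun τ hτ => ?_
    have hτ : 0 < τ := hτ
    simp only [abs_neg, abs_one, one_mul, smul_eq_mul]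
    rw [← mul_assoc, ← Real.rpow_mul hτ.le, ← Real.rpow_add hτ, Real.rpow_neg_one]
    congr 2
    · ring
    · field_simp
  rw [h2, one_div_div, Real.div_rpow (by norm_num) (by positivity), Real.rpow_mul hr.le,
    Real.rpow_two]
  ring

variable {N : ℕ}

/-- The Fourier symbol of the centered difference of order `2m` with step `y`. -/
noncomputable def diffSymbol (m : ℕ) (ξ y : Space N) : ℝ := (2 - 2 * Real.cos (inner ℝ y ξ)) ^ m

theorem diffSymbol_nonneg (m : ℕ) (ξ y : Space N) : 0 ≤ diffSymbol m ξ y :=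
  pow_nonneg (by linarith [Real.cos_le_one (inner ℝ y ξ)]) m

@[fun_prop]
theorem continuous_diffSymbol_uncurry (m : ℕ) :
    Continuous fun q : Space N × Space N => diffSymbol m q.1 q.2 := by
  unfold diffSymbol
  fun_prop

theorem continuous_diffSymbol (m : ℕ) (ξ : Space N) : Continuous (diffSymbol m ξ) := by
  unfold diffSymbol
  fun_prop

theorem diffSymbol_zero_right {m : ℕ} (hm : 1 ≤ m) (ξ : Space N) : diffSymbol m ξ 0 = 0 := by
  simp [diffSymbol]
  omega

theorem diffSymbol_zero_left {m : ℕ} (hm : 1 ≤ m) (y : Space N) : diffSymbol m 0 y = 0 := by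
  simp [diffSymbol]
  omega

/-- The Gaussian means of the symbol are sums of decaying exponentials. -/
theorem integrable_diffSymbol_mul_gaussian (m : ℕ) (ξ : Space N) {τ : ℝ} (hτ : 0 < τ) :
    Integrable (fun y => diffSymbol m ξ y * Real.exp (-(‖y‖ ^ 2 / (4 * τ)))) ∧
    ∫ y, diffSymbol m ξ y * Real.exp (-(‖y‖ ^ 2 / (4 * τ))) =
      (4 * Real.pi * τ) ^ ((N : ℝ) / 2) * expSum (Finset.Icc (-(m : ℤ)) m) (diffWeight m)
        (fun k => (k : ℝ) ^ 2 * ‖ξ‖ ^ 2) τ := by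
  set b : ℂ := (((4 * τ)⁻¹ : ℝ) : ℂ) with hb
  have hbre : 0 < b.re := by
    rw [hb, Complex.ofReal_re]
    positivity
  have hfun : ∀ y : Space N, ((diffSymbol m ξ y * Real.exp (-(‖y‖ ^ 2 / (4 * τ))) : ℝ) : ℂ) =
      ∑ k ∈ Finset.Icc (-(m : ℤ)) m, (diffWeight m k : ℂ) *
        Complex.exp (-b * ‖y‖ ^ 2 + (Complex.I * (k : ℂ)) * (inner ℝ ξ y : ℝ)) := by
    intro y
    rw [diffSymbol, Complex.ofReal_mul, ← sum_diffWeight_mul_exp, Finset.sum_mul]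
    refine Finset.sum_congr rfl fun k _ => ?_
    rw [mul_assoc, Complex.ofReal_exp, ← Complex.exp_add, real_inner_comm, hb]
    congr 2
    push_cast
    field_simp
    ring
  have hint : ∀ k ∈ Finset.Icc (-(m : ℤ)) m, Integrable fun y : Space N =>
      (diffWeight m k : ℂ) *
        Complex.exp (-b * ‖y‖ ^ 2 + (Complex.I * (k : ℂ)) * (inner ℝ ξ y : ℝ)) := fun k _ =>
    (GaussianFourier.integrable_cexp_neg_mul_sq_norm_add hbre _ _).const_mul _
  have hI : Integrable fun y : Space N =>
      ((diffSymbol m ξ y * Real.exp (-(‖y‖ ^ 2 / (4 * τ))) : ℝ) : ℂ) := by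
    simp only [hfun]
    exact integrable_finsetSum _ hint
  refine ⟨by simpa only [RCLike.re_to_complex, Complex.ofReal_re] using hI.re, ?_⟩
  rw [← Complex.ofReal_inj, ← integral_complex_ofReal]
  simp only [hfun]
  rw [integral_finsetSum _ hint, expSum, Complex.ofReal_mul, Complex.ofReal_sum, Finset.mul_sum]
  refine Finset.sum_congr rfl fun k _ => ?_
  rw [integral_const_mul, GaussianFourier.integral_cexp_neg_mul_sq_norm_add hbre]
  have h1 : ((Real.pi : ℂ) / b) ^ ((Module.finrank ℝ (Space N) : ℂ) / 2) =
      (((4 * Real.pi * τ) ^ ((N : ℝ) / 2) : ℝ) : ℂ) := by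
    rw [Complex.ofReal_cpow (by positivity), hb]
    congr 1
    · push_cast
      field_simp
    · simp
  have h2 : Complex.exp ((Complex.I * (k : ℂ)) ^ 2 * ‖ξ‖ ^ 2 / (4 * b)) =
      ((Real.exp (-((k : ℝ) ^ 2 * ‖ξ‖ ^ 2 * τ)) : ℝ) : ℂ) := by
    rw [Complex.ofReal_exp, mul_pow, Complex.I_sq, hb]
    congr 1
    push_cast
    field_simp
  rw [h1, h2]
  push_cast
  ring

theorem sum_diffWeight_mul_sq_pow (m : ℕ) (c : ℝ) : ∀ j < m,
    ∑ k ∈ Finset.Icc (-(m : ℤ)) m, diffWeight m k * ((k : ℝ) ^ 2 * c) ^ j = 0 := by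
  intro j hj
  rw [← mul_zero (c ^ j), ← sum_diffWeight_mul_pow m (2 * j) (by omega), Finset.mul_sum]
  refine Finset.sum_congr rfl fun k _ => ?_
  rw [mul_pow, ← pow_mul]
  ring

/-- The integral of the symbol against `|y|^{-N-2s}`, as a Mellin transform of a sum of
exponentials. -/
theorem integral_diffSymbol_div {m : ℕ} (hm : 1 ≤ m) {s : ℝ} (hs0 : 0 < s) (hs : s < m)
    (ξ : Space N) :
    Integrable (fun y => diffSymbol m ξ y / ‖y‖ ^ ((N : ℝ) + 2 * s)) ∧
    Real.Gamma ((N : ℝ) / 2 + s) * 4 ^ ((N : ℝ) / 2 + s) *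
        ∫ y, diffSymbol m ξ y / ‖y‖ ^ ((N : ℝ) + 2 * s) =
      (4 * Real.pi) ^ ((N : ℝ) / 2) * ∫ τ in Ioi (0 : ℝ), τ ^ (-s - 1) *
        expSum (Finset.Icc (-(m : ℤ)) m) (diffWeight m) (fun k => (k : ℝ) ^ 2 * ‖ξ‖ ^ 2) τ := by
  set p : ℝ := (N : ℝ) / 2 + s with hp
  have hp0 : 0 < p := by positivity
  have h2p : (N : ℝ) + 2 * s = 2 * p := by rw [hp]; ring
  have hC : 0 < Real.Gamma p * 4 ^ p :=
    mul_pos (Real.Gamma_pos_of_pos hp0) (Real.rpow_pos_of_pos (by norm_num) _)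
  -- Integrating `F` in `τ` first gives the power kernel; in `y` first, the exponential sum.
  set F : Space N → ℝ → ℝ := fun y τ =>
    diffSymbol m ξ y * (τ ^ (-p - 1) * Real.exp (-(‖y‖ ^ 2 / (4 * τ)))) with hF
  have hFy : ∀ y, ∫ τ in Ioi (0 : ℝ), F y τ =
      Real.Gamma p * 4 ^ p * (diffSymbol m ξ y / ‖y‖ ^ ((N : ℝ) + 2 * s)) := by
    intro y
    simp only [hF, integral_const_mul]
    rcases eq_or_ne y 0 with rfl | hy
    · simp [diffSymbol_zero_right hm]
    · rw [integral_rpow_mul_exp_neg_div hp0 (norm_pos_iff.2 hy), h2p]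
      ring
  have hFτ : ∀ τ ∈ Ioi (0 : ℝ), Integrable (fun y => F y τ) ∧
      ∫ y, F y τ = (4 * Real.pi) ^ ((N : ℝ) / 2) * (τ ^ (-s - 1) *
        expSum (Finset.Icc (-(m : ℤ)) m) (diffWeight m) (fun k => (k : ℝ) ^ 2 * ‖ξ‖ ^ 2) τ) := by
    intro τ hτ
    have hτ : 0 < τ := hτ
    obtain ⟨h1, h2⟩ := integrable_diffSymbol_mul_gaussian m ξ hτ
    have h3 : (fun y => F y τ) = fun y =>
        τ ^ (-p - 1) * (diffSymbol m ξ y * Real.exp (-(‖y‖ ^ 2 / (4 * τ)))) := by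
      ext y
      simp only [hF]
      ring
    rw [h3]
    refine ⟨h1.const_mul _, ?_⟩
    rw [integral_const_mul, h2, Real.mul_rpow (by positivity) hτ.le]
    have h4 : τ ^ (-p - 1) * τ ^ ((N : ℝ) / 2) = τ ^ (-s - 1) := by
      rw [← Real.rpow_add hτ]
      congr 1
      rw [hp]
      ring
    rw [← h4]
    ring
  have hnn : ∀ y, ∀ τ ∈ Ioi (0 : ℝ), 0 ≤ F y τ := fun y τ hτ =>
    mul_nonneg (diffSymbol_nonneg _ _ _)
      (mul_nonneg (Real.rpow_nonneg (mem_Ioi.1 hτ).le _) (Real.exp_pos _).le)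
  have hmeas : Measurable (Function.uncurry F) := by
    have h1 : Measurable fun q : Space N × ℝ => diffSymbol m ξ q.1 :=
      (continuous_diffSymbol m ξ).measurable.comp measurable_fst
    have h2 : Measurable fun q : Space N × ℝ => q.2 ^ (-p - 1) := by fun_prop
    have h3 : Measurable fun q : Space N × ℝ => Real.exp (-(‖q.1‖ ^ 2 / (4 * q.2))) := by fun_prop
    exact h1.mul (h2.mul h3)
  have hint : Integrable (Function.uncurry F)
      ((volume : Measure (Space N)).prod (volume.restrict (Ioi (0 : ℝ)))) := by
    -- As `F` is nonnegative, joint integrability reduces to that of the exponential sum in `τ`.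
    rw [integrable_prod_iff' hmeas.aestronglyMeasurable]
    refine ⟨(ae_restrict_mem measurableSet_Ioi).mono fun τ hτ => (hFτ τ hτ).1, ?_⟩
    have hexp := integrableOn_rpow_mul_expSum_of_pos (t := Finset.Icc (-(m : ℤ)) m)
      (b := diffWeight m) (l := fun k => (k : ℝ) ^ 2 * ‖ξ‖ ^ 2) (fun _ _ => by positivity)
      (sum_diffWeight_mul_sq_pow m (‖ξ‖ ^ 2)) hs0 hs
    refine IntegrableOn.congr_fun (hexp.const_mul ((4 * Real.pi) ^ ((N : ℝ) / 2)))
      (fun τ hτ => ?_) measurableSet_Ioi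
    simp only [Function.uncurry_apply_pair]
    rw [← (hFτ τ hτ).2]
    exact integral_congr_ae (Eventually.of_forall fun y => (Real.norm_of_nonneg (hnn y τ hτ)).symm)
  have hleft := hint.integral_prod_left
  simp only [Function.uncurry_apply_pair, hFy] at hleft
  refine ⟨?_, ?_⟩
  · have := hleft.const_mul (Real.Gamma p * 4 ^ p)⁻¹
    refine this.congr (Eventually.of_forall fun y => ?_)
    simp only [← mul_assoc, inv_mul_cancel₀ hC.ne', one_mul]
  · have hswap := integral_integral_swap hint
    simp only [hFy] at hswap
    rw [← integral_const_mul, hswap, ← integral_const_mul]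
    exact setIntegral_congr_fun measurableSet_Ioi fun τ hτ => (hFτ τ hτ).2

/-- The symbol is positive on the open slab $0<y\cdot\xi<2\pi$, which is nonempty and hence of
positive measure. -/
theorem integral_diffSymbol_div_pos {m : ℕ} (hm : 1 ≤ m) {s : ℝ} (hs0 : 0 < s) (hs : s < m)
    {ξ : Space N} (hξ : ξ ≠ 0) :
    0 < ∫ y, diffSymbol m ξ y / ‖y‖ ^ ((N : ℝ) + 2 * s) := by
  have hnn : ∀ y : Space N, 0 ≤ diffSymbol m ξ y / ‖y‖ ^ ((N : ℝ) + 2 * s) := fun y =>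
    div_nonneg (diffSymbol_nonneg _ _ _) (by positivity)
  rw [integral_pos_iff_support_of_nonneg hnn (integral_diffSymbol_div hm hs0 hs ξ).1]
  have hopen : IsOpen {y : Space N | inner ℝ y ξ ∈ Ioo 0 (2 * Real.pi)} :=
    isOpen_Ioo.preimage (by fun_prop)
  have hne : {y : Space N | inner ℝ y ξ ∈ Ioo 0 (2 * Real.pi)}.Nonempty := by
    refine ⟨(Real.pi / ‖ξ‖ ^ 2) • ξ, ?_⟩
    have h1 : ‖ξ‖ ^ 2 ≠ 0 := pow_ne_zero _ (norm_ne_zero_iff.2 hξ)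
    rw [mem_ofPred, real_inner_smul_left, real_inner_self_eq_norm_sq, div_mul_cancel₀ _ h1]
    exact ⟨Real.pi_pos, by linarith [Real.pi_pos]⟩
  refine lt_of_lt_of_le (hopen.measure_pos volume hne) (measure_mono fun y hy => ?_)
  have hy0 : y ≠ 0 := by
    rintro rfl
    simp at hy
  have hcos : Real.cos (inner ℝ y ξ) ≠ 1 := by
    rw [Ne, Real.cos_eq_one_iff_of_lt_of_lt (by linarith [hy.1, Real.pi_pos]) hy.2]
    exact hy.1.ne'
  rw [Function.mem_support]
  refine div_ne_zero (pow_ne_zero _ fun h => hcos (by linarith)) ?_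
  exact (Real.rpow_pos_of_pos (norm_pos_iff.2 hy0) _).ne'

theorem sq_mul_sq_rpow (s x : ℝ) {r : ℝ} (hr : 0 ≤ r) :
    (x ^ 2 * r ^ 2) ^ s = |x| ^ (2 * s) * r ^ (2 * s) := by
  rw [← sq_abs x, Real.mul_rpow (by positivity) (by positivity), Real.rpow_mul (abs_nonneg x),
    Real.rpow_mul hr, Real.rpow_two, Real.rpow_two]

/-- The normalization of `L_{m,s}`: its symbol is `|ξ|^{2s}`. -/
theorem normConst_mul_integral_diffSymbol_div {m : ℕ} (hm : 1 ≤ m) {s : ℝ} (hs0 : 0 < s)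
    (hs : s < m) (ξ : Space N) :
    normConst N m s / 2 * ∫ y, diffSymbol m ξ y / ‖y‖ ^ ((N : ℝ) + 2 * s) = ‖ξ‖ ^ (2 * s) := by
  rcases eq_or_ne ξ 0 with rfl | hξ
  · simp [diffSymbol_zero_left hm, Real.zero_rpow (by positivity : (2 * s) ≠ 0)]
  have hr : 0 < ‖ξ‖ := norm_pos_iff.2 hξ
  obtain ⟨-, hI⟩ := integral_diffSymbol_div hm hs0 hs ξ
  have hpos := integral_diffSymbol_div_pos hm hs0 hs hξ
  set I := ∫ y, diffSymbol m ξ y / ‖y‖ ^ ((N : ℝ) + 2 * s)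
  set p : ℝ := (N : ℝ) / 2 + s with hp
  have hp0 : 0 < p := by positivity
  have hΓ := Real.Gamma_pos_of_pos hp0
  have h4 : (0 : ℝ) < 4 ^ s := Real.rpow_pos_of_pos (by norm_num) _
  have hpi : (0 : ℝ) < Real.pi ^ ((N : ℝ) / 2) := Real.rpow_pos_of_pos Real.pi_pos _
  have hN4 : (0 : ℝ) < 4 ^ ((N : ℝ) / 2) := Real.rpow_pos_of_pos (by norm_num) _
  rw [hp, Real.rpow_add (by norm_num), Real.mul_rpow (by norm_num) Real.pi_pos.le, ← hp] at hI
  set J := ∫ τ in Ioi (0 : ℝ), τ ^ (-s - 1) *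
        expSum (Finset.Icc (-(m : ℤ)) m) (diffWeight m) (fun k => (k : ℝ) ^ 2 * ‖ξ‖ ^ 2) τ with hJ
  have hI' : Real.Gamma p * 4 ^ s * I = Real.pi ^ ((N : ℝ) / 2) * J := by
    refine mul_left_cancel₀ hN4.ne' ?_
    linarith
  -- This positivity later shows that the sum `S` inverted in the constant, and $\Gamma(-s)$, are
  -- nonzero.
  have hJpos : 0 < J := by
    have : 0 < Real.pi ^ ((N : ℝ) / 2) * J := hI' ▸ mul_pos (mul_pos hΓ h4) hpos
    exact (mul_pos_iff_of_pos_left hpi).1 this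
  have hl : ∀ k ∈ Finset.Icc (-(m : ℤ)) m, 0 ≤ (k : ℝ) ^ 2 * ‖ξ‖ ^ 2 := fun _ _ => by positivity
  have hM := sum_diffWeight_mul_sq_pow m (‖ξ‖ ^ 2)
  have hr2 : 0 < ‖ξ‖ ^ (2 * s) := Real.rpow_pos_of_pos hr _
  rw [normConst, ← hp]
  split_ifs with hfl
  · obtain ⟨n, hn⟩ : ∃ n, ⌊s⌋₊ = n + 1 := by
      refine Nat.exists_eq_succ_of_ne_zero fun h => ?_
      rw [h] at hfl
      simp at hfl
      linarith
    rw [hn] at hfl ⊢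
    have hnm : n + 1 < m := by
      rw [hfl] at hs
      exact_mod_cast hs
    set S := ∑ k ∈ Finset.Icc 2 m, (-1 : ℝ) ^ ((k : ℤ) - ((n + 1 : ℕ) : ℤ) + 1) *
        (Nat.choose (2 * m) (m - k) : ℝ) * (k : ℝ) ^ (2 * s) * Real.log (k : ℝ) with hS
    have hJS : J = 4 / (Nat.factorial (n + 1) : ℝ) * S * ‖ξ‖ ^ (2 * s) := by
      have h1 := integral_rpow_mul_expSum_natCast n hl (fun j hj => hM j (by omega))
      rw [← hfl, ← hJ] at h1
      have h2 : ∑ k ∈ Finset.Icc (-(m : ℤ)) m, diffWeight m k * ((k : ℝ) ^ 2 * ‖ξ‖ ^ 2) ^ (n + 1) *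
          Real.log ((k : ℝ) ^ 2 * ‖ξ‖ ^ 2) = ‖ξ‖ ^ (2 * s) *
          (2 * ∑ k ∈ Finset.Icc (-(m : ℤ)) m, diffWeight m k *
            (|(k : ℝ)| ^ (2 * s) * Real.log (k : ℝ))) := by
        -- The logarithm splits as $2\log|k|+\log|\xi|^2$; the second part multiplies the moment of
        -- order $n+1<m$, which is zero, so it is added here for free.
        rw [← add_zero (‖ξ‖ ^ (2 * s) * _), ← mul_zero (Real.log (‖ξ‖ ^ 2)),
          ← hM (n + 1) hnm, Finset.mul_sum, Finset.mul_sum, Finset.mul_sum,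
          ← Finset.sum_add_distrib]
        refine Finset.sum_congr rfl fun k _ => ?_
        rcases eq_or_ne k 0 with rfl | hk
        · simp
        · have hk' : (k : ℝ) ^ 2 ≠ 0 := pow_ne_zero _ (Int.cast_ne_zero.2 hk)
          have h3 := sq_mul_sq_rpow s (k : ℝ) hr.le
          rw [hfl, Real.rpow_natCast, ← hfl] at h3
          rw [Real.log_mul hk' (by positivity), h3, Real.log_pow]
          push_cast
          ring
      have h3 := sum_diffWeight_mul_even m (fun x => |x| ^ (2 * s) * Real.log x)
        (fun x => by rw [abs_neg, Real.log_neg_eq_log]) (by simp)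
      have h4 : ∑ k ∈ Finset.Icc 1 m, (-1 : ℝ) ^ k * (Nat.choose (2 * m) (m - k) : ℝ) *
          (|(k : ℝ)| ^ (2 * s) * Real.log k) = (-1) ^ n * S := by
        -- The term $k=1$ drops out since $\log 1=0$, so the sum starts at $2$.
        rw [← Finset.add_sum_Ioc_eq_sum_Icc hm]
        simp only [Nat.cast_one, Real.log_one, mul_zero, zero_add, hS, Finset.mul_sum]
        refine Finset.sum_congr rfl fun k _ => ?_
        have h5 : (-1 : ℝ) ^ ((k : ℤ) - ((n + 1 : ℕ) : ℤ) + 1) = (-1) ^ n * (-1) ^ k := by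
          have : (k : ℤ) - ((n + 1 : ℕ) : ℤ) + 1 = k - n := by push_cast; ring
          rw [this, zpow_sub₀ (by norm_num), zpow_natCast, zpow_natCast, div_eq_mul_inv,
            ← inv_pow, mul_comm]
          norm_num
        have h6 : ((-1 : ℝ) ^ n) * (-1) ^ n = 1 := by rw [← mul_pow]; norm_num
        rw [h5, abs_of_nonneg k.cast_nonneg]
        linear_combination -(-1 : ℝ) ^ k * (Nat.choose (2 * m) (m - k) : ℝ) *
          ((k : ℝ) ^ (2 * s) * Real.log k) * h6
      have h6 : ((-1 : ℝ) ^ n) * (-1) ^ n = 1 := by rw [← mul_pow]; norm_num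
      rw [h1, h2, h3, h4]
      linear_combination (4 / (Nat.factorial (n + 1) : ℝ) * S * ‖ξ‖ ^ (2 * s)) * h6
    have hfac : (0 : ℝ) < (Nat.factorial (n + 1) : ℝ) := by positivity
    have hS0 : S ≠ 0 := by
      intro h
      rw [hJS, h] at hJpos
      simp at hJpos
    rw [hJS] at hI'
    have hIeq : I = Real.pi ^ ((N : ℝ) / 2) * (4 / (Nat.factorial (n + 1) : ℝ) * S *
        ‖ξ‖ ^ (2 * s)) / (Real.Gamma p * 4 ^ s) := by
      rw [eq_div_iff (mul_pos hΓ h4).ne', ← hI']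
      ring
    rw [hIeq]
    field_simp
    norm_num
  · set S := ∑ k ∈ Finset.Icc 1 m, (-1 : ℝ) ^ k * (Nat.choose (2 * m) (m - k) : ℝ) *
      (k : ℝ) ^ (2 * s) with hS
    have hJS : J = Real.Gamma (-s) * (2 * S) * ‖ξ‖ ^ (2 * s) := by
      have hlt : (⌊s⌋₊ : ℝ) < s := lt_of_le_of_ne (Nat.floor_le hs0.le) (Ne.symm hfl)
      have hfm : ⌊s⌋₊ < m := by exact_mod_cast hlt.trans hs
      have h1 := integral_rpow_mul_expSum_of_mem_Ioo ⌊s⌋₊ hl (fun j hj => hM j (by omega)) hlt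
        (Nat.lt_floor_add_one s)
      have h3 := sum_diffWeight_mul_even m (fun x => |x| ^ (2 * s)) (fun x => by rw [abs_neg])
        (by simp [Real.zero_rpow, hs0.ne'])
      simp only [Nat.abs_cast] at h3
      rw [← hJ] at h1
      rw [h1, hS, ← h3, mul_assoc, Finset.sum_mul]
      congr 1
      refine Finset.sum_congr rfl fun k _ => ?_
      rw [sq_mul_sq_rpow s _ hr.le]
      ring
    have hS0 : S ≠ 0 := by
      intro h
      rw [hJS, h] at hJpos
      simp at hJpos
    have hG0 : Real.Gamma (-s) ≠ 0 := by
      intro h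
      rw [hJS, h] at hJpos
      simp at hJpos
    rw [hJS] at hI'
    have hIeq : I = Real.pi ^ ((N : ℝ) / 2) * (Real.Gamma (-s) * (2 * S) * ‖ξ‖ ^ (2 * s)) /
        (Real.Gamma p * 4 ^ s) := by
      rw [eq_div_iff (mul_pos hΓ h4).ne', ← hI']
      ring
    rw [hIeq]
    field_simp

/-! ### Fourier inversion for test functions. -/

open scoped FourierTransform SchwartzMap

theorem norm_cexp_I_mul_ofReal (x : ℝ) : ‖Complex.exp (Complex.I * (x : ℂ))‖ = 1 := by
  rw [mul_comm, Complex.norm_exp_ofReal_mul_I]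

theorem fourierF_eq_fourier (u : Space N → ℂ) (ξ : Space N) :
    fourierF u ξ = (((2 * Real.pi) ^ (-((N : ℝ) / 2)) : ℝ) : ℂ) *
      𝓕 u ((2 * Real.pi)⁻¹ • ξ) := by
  rw [fourierF, Real.fourier_eq']
  congr 1
  refine integral_congr_ae (Eventually.of_forall fun x => ?_)
  simp only [smul_eq_mul, real_inner_smul_right]
  congr 2
  have : (Real.pi : ℂ) ≠ 0 := by exact_mod_cast Real.pi_ne_zero
  push_cast
  field_simp

/-- The Fourier transform of a test function is a Schwartz function. -/
theorem exists_schwartz_fourierF {u : Space N → ℂ} (hu : ContDiff ℝ ∞ u)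
    (hc : HasCompactSupport u) : ∃ γ : 𝓢(Space N, ℂ), fourierF u = γ := by
  let e : Space N ≃L[ℝ] Space N :=
    ContinuousLinearEquiv.smulLeft (Units.mk0 (2 * Real.pi)⁻¹ (by positivity))
  refine ⟨(((2 * Real.pi) ^ (-((N : ℝ) / 2)) : ℝ) : ℂ) •
    SchwartzMap.compCLMOfContinuousLinearEquiv ℂ e (𝓕 (hc.toSchwartzMap hu)), ?_⟩
  ext ξ
  rw [fourierF_eq_fourier]
  rfl

/-- Rescaling frequencies by $2\pi$ reduces to Schwartz inversion; the Jacobian $(2\pi)^N$ cancels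
the two prefactors. -/
theorem fourierFInv_fourierF {u : Space N → ℂ} (hu : ContDiff ℝ ∞ u)
    (hc : HasCompactSupport u) (x : Space N) : fourierFInv (fourierF u) x = u x := by
  have hinv : 𝓕⁻ (𝓕 u) x = u x := by
    have := congrFun ((hc.toSchwartzMap hu).continuous.fourierInv_fourier_eq
      (hc.toSchwartzMap hu).integrable (𝓕 (hc.toSchwartzMap hu)).integrable) x
    exact this
  rw [Real.fourierInv_eq'] at hinv
  have h2pi : (0 : ℝ) < 2 * Real.pi := by positivity
  have h1 : ∫ ξ, Complex.exp (Complex.I * ((inner ℝ x ξ : ℝ) : ℂ)) *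
      𝓕 u ((2 * Real.pi)⁻¹ • ξ) = ((2 * Real.pi) ^ N : ℝ) • u x := by
    rw [← hinv]
    have h2 := Measure.integral_comp_inv_smul_of_nonneg (volume : Measure (Space N))
      (fun v => Complex.exp (((2 * Real.pi * inner ℝ v x : ℝ) : ℂ) * Complex.I) • 𝓕 u v) h2pi.le
    rw [finrank_euclideanSpace_fin] at h2
    rw [← h2]
    refine integral_congr_ae (Eventually.of_forall fun ξ => ?_)
    simp only [smul_eq_mul, real_inner_smul_left]
    rw [mul_inv_cancel_left₀ h2pi.ne', real_inner_comm, mul_comm Complex.I]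
  have h3 : (2 * Real.pi) ^ (-((N : ℝ) / 2)) * ((2 * Real.pi) ^ (-((N : ℝ) / 2)) *
      (2 * Real.pi) ^ N) = 1 := by
    rw [← Real.rpow_natCast, ← Real.rpow_add h2pi, ← Real.rpow_add h2pi]
    convert Real.rpow_zero (2 * Real.pi) using 2
    ring
  simp only [fourierFInv, fourierF_eq_fourier]
  simp only [mul_left_comm _ (((2 * Real.pi) ^ (-((N : ℝ) / 2)) : ℝ) : ℂ), integral_const_mul]
  rw [h1, Complex.real_smul, ← mul_assoc, ← mul_assoc, ← Complex.ofReal_mul, ← Complex.ofReal_mul,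
    mul_assoc ((2 * Real.pi) ^ (-((N : ℝ) / 2))), h3, Complex.ofReal_one, one_mul]

/-- Centered differences of a test function, expressed by Fourier inversion. -/
theorem finDiff_eq_integral (m : ℕ) {u : Space N → ℂ} (hu : ContDiff ℝ ∞ u)
    (hc : HasCompactSupport u) (x y : Space N) :
    finDiff m u x y = (((2 * Real.pi) ^ (-((N : ℝ) / 2)) : ℝ) : ℂ) *
      ∫ ξ, Complex.exp (Complex.I * ((inner ℝ x ξ : ℝ) : ℂ)) *
        ((diffSymbol m ξ y : ℂ) * fourierF u ξ) := by
  obtain ⟨γ, hγ⟩ := exists_schwartz_fourierF hu hc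
  have hint : ∀ z : Space N, Integrable fun ξ =>
      Complex.exp (Complex.I * ((inner ℝ z ξ : ℝ) : ℂ)) * fourierF u ξ := by
    intro z
    rw [hγ]
    refine γ.integrable.bdd_mul (c := 1) (Continuous.aestronglyMeasurable (by fun_prop)) ?_
    exact Eventually.of_forall fun ξ => (norm_cexp_I_mul_ofReal _).le
  have h1 : ∀ k : ℤ, (-1 : ℂ) ^ k * (Nat.choose (2 * m) ((m : ℤ) - k).toNat : ℂ) =
      (diffWeight m k : ℂ) := fun k => by simp [diffWeight]
  simp only [finDiff, h1]
  have h2 : ∀ ξ : Space N, Complex.exp (Complex.I * ((inner ℝ x ξ : ℝ) : ℂ)) *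
        ((diffSymbol m ξ y : ℂ) * fourierF u ξ) = ∑ k ∈ Finset.Icc (-(m : ℤ)) m,
      (diffWeight m k : ℂ) * (Complex.exp (Complex.I *
        ((inner ℝ (x + (k : ℝ) • y) ξ : ℝ) : ℂ)) * fourierF u ξ) := by
    intro ξ
    rw [diffSymbol, ← sum_diffWeight_mul_exp, Finset.sum_mul, Finset.mul_sum]
    refine Finset.sum_congr rfl fun k _ => ?_
    rw [inner_add_left, real_inner_smul_left, Complex.ofReal_add, mul_add, Complex.exp_add]
    ring
  simp only [h2]
  rw [integral_finsetSum _ fun k _ => (hint _).const_mul _, Finset.mul_sum]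
  refine Finset.sum_congr rfl fun k _ => ?_
  rw [integral_const_mul, mul_left_comm]
  congr 1
  exact (fourierFInv_fourierF hu hc _).symm

theorem memLp_two_of_integrable_of_bound {f : Space N → ℂ} (hf : Integrable f) {C : ℝ}
    (hC : ∀ x, ‖f x‖ ≤ C) : MemLp f 2 := by
  rw [memLp_two_iff_integrable_sq_norm hf.aestronglyMeasurable]
  refine (hf.norm.const_mul C).mono' (hf.aestronglyMeasurable.norm.pow 2)
    (Eventually.of_forall fun x => ?_)
  rw [Real.norm_of_nonneg (by positivity), sq]
  exact mul_le_mul_of_nonneg_right (hC x) (norm_nonneg _)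

theorem rpow_two_mul_le {m : ℕ} {s : ℝ} (hs0 : 0 < s) (hs : s < m) {r : ℝ} (hr : 0 ≤ r) :
    r ^ (2 * s) ≤ 1 + r ^ (2 * m) := by
  rcases le_total r 1 with h | h
  · have := Real.rpow_le_one hr h (by positivity : 0 ≤ 2 * s)
    have : 0 ≤ r ^ (2 * m) := by positivity
    linarith
  · have h1 : r ^ (2 * s) ≤ r ^ ((2 * m : ℕ) : ℝ) :=
      Real.rpow_le_rpow_of_exponent_le h (by push_cast; linarith)
    rw [Real.rpow_natCast] at h1
    linarith

/-! ### Integrability of the multiplied transform. -/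

section symbolMul

variable {m : ℕ} {s : ℝ} {u : Space N → ℂ}

theorem norm_symbolMul_le (hs0 : 0 < s) (hs : s < m) (ξ : Space N) :
    ‖symbolMul s u ξ‖ ≤ ‖fourierF u ξ‖ + ‖ξ‖ ^ (2 * m) * ‖fourierF u ξ‖ := by
  rw [symbolMul, norm_mul, Complex.norm_real, Real.norm_of_nonneg (by positivity)]
  have := mul_le_mul_of_nonneg_right (rpow_two_mul_le hs0 hs (norm_nonneg ξ))
    (norm_nonneg (fourierF u ξ))
  linarith

theorem continuous_symbolMul (hu : ContDiff ℝ ∞ u) (hc : HasCompactSupport u) (hs0 : 0 < s) :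
    Continuous (symbolMul s u) := by
  obtain ⟨γ, hγ⟩ := exists_schwartz_fourierF hu hc
  unfold symbolMul
  rw [hγ]
  refine (Complex.continuous_ofReal.comp ?_).mul γ.continuous
  exact continuous_norm.rpow_const fun _ => Or.inr (by positivity)

theorem integrable_symbolMul (hu : ContDiff ℝ ∞ u) (hc : HasCompactSupport u) (hs0 : 0 < s)
    (hs : s < m) : Integrable (symbolMul s u) := by
  have hcont := continuous_symbolMul hu hc hs0
  obtain ⟨γ, hγ⟩ := exists_schwartz_fourierF hu hc
  refine (γ.integrable.norm.add (γ.integrable_pow_mul volume (2 * m))).mono'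
    hcont.aestronglyMeasurable (Eventually.of_forall fun ξ => ?_)
  have := norm_symbolMul_le (u := u) hs0 hs ξ
  rwa [hγ] at this

theorem memLp_two_symbolMul (hu : ContDiff ℝ ∞ u) (hc : HasCompactSupport u) (hs0 : 0 < s)
    (hs : s < m) : MemLp (symbolMul s u) 2 := by
  obtain ⟨γ, hγ⟩ := exists_schwartz_fourierF hu hc
  obtain ⟨C, -, hC⟩ := γ.decay 0 0
  obtain ⟨D, -, hD⟩ := γ.decay (2 * m) 0
  refine memLp_two_of_integrable_of_bound (integrable_symbolMul hu hc hs0 hs) (C := C + D)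
    fun ξ => (norm_symbolMul_le hs0 hs ξ).trans ?_
  have h1 := hC ξ
  have h2 := hD ξ
  simp only [norm_iteratedFDeriv_zero, pow_zero, one_mul] at h1 h2
  rw [hγ]
  exact add_le_add h1 h2

end symbolMul

/-! ### Exchange of the integrals in $y$ and $\xi$. -/

section Fubini

variable {m : ℕ} {s : ℝ} {u : Space N → ℂ}

/-- The symbol is nonnegative, so integrating the norm in `y` gives exactly a multiple of
$|\xi|^{2s}|\mathcal F u(\xi)|$, which is integrable. -/
theorem integrable_prod_symbol (hm : 1 ≤ m) (hu : ContDiff ℝ ∞ u) (hc : HasCompactSupport u)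
    (hs0 : 0 < s) (hs : s < m) (x : Space N) :
    Integrable (Function.uncurry fun y ξ : Space N =>
      Complex.exp (Complex.I * ((inner ℝ x ξ : ℝ) : ℂ)) *
        (((diffSymbol m ξ y / ‖y‖ ^ ((N : ℝ) + 2 * s) : ℝ) : ℂ) * fourierF u ξ))
      (volume.prod volume) := by
  have hsym := (integrable_symbolMul hu hc hs0 hs).norm
  obtain ⟨γ, hγ⟩ := exists_schwartz_fourierF hu hc
  have hmeas : Measurable (Function.uncurry fun y ξ : Space N =>
      Complex.exp (Complex.I * ((inner ℝ x ξ : ℝ) : ℂ)) *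
        (((diffSymbol m ξ y / ‖y‖ ^ ((N : ℝ) + 2 * s) : ℝ) : ℂ) * fourierF u ξ)) := by
    rw [hγ]
    have h1 : Measurable fun q : Space N × Space N =>
        Complex.exp (Complex.I * ((inner ℝ x q.2 : ℝ) : ℂ)) :=
      Continuous.measurable (by fun_prop)
    have h2 : Measurable fun q : Space N × Space N => diffSymbol m q.2 q.1 :=
      ((continuous_diffSymbol_uncurry m).comp continuous_swap).measurable
    have h3 : Measurable fun q : Space N × Space N => ‖q.1‖ ^ ((N : ℝ) + 2 * s) := by fun_prop
    have h4 : Measurable fun q : Space N × Space N => γ q.2 :=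
      γ.continuous.measurable.comp measurable_snd
    exact h1.mul ((Complex.measurable_ofReal.comp (h2.div h3)).mul h4)
  have hnorm : ∀ y ξ : Space N, ‖Complex.exp (Complex.I * ((inner ℝ x ξ : ℝ) : ℂ)) *
      (((diffSymbol m ξ y / ‖y‖ ^ ((N : ℝ) + 2 * s) : ℝ) : ℂ) * fourierF u ξ)‖ =
      diffSymbol m ξ y / ‖y‖ ^ ((N : ℝ) + 2 * s) * ‖fourierF u ξ‖ := by
    intro y ξ
    rw [norm_mul, norm_cexp_I_mul_ofReal, one_mul, norm_mul, Complex.norm_real,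
      Real.norm_of_nonneg (div_nonneg (diffSymbol_nonneg _ _ _) (by positivity))]
  rw [integrable_prod_iff' hmeas.aestronglyMeasurable]
  refine ⟨Eventually.of_forall fun ξ => ?_, ?_⟩
  · simp only [Function.uncurry_apply_pair]
    exact (((integral_diffSymbol_div hm hs0 hs ξ).1.ofReal (𝕜 := ℂ)).mul_const _).const_mul _
  · simp only [Function.uncurry_apply_pair, hnorm, integral_mul_const]
    refine (hsym.const_mul (normConst N m s / 2)⁻¹).congr (Eventually.of_forall fun ξ => ?_)
    simp only
    rw [symbolMul, norm_mul, Complex.norm_real, Real.norm_of_nonneg (by positivity), ← mul_assoc]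
    congr 1
    rw [← normConst_mul_integral_diffSymbol_div hm hs0 hs ξ]
    rcases eq_or_ne ξ 0 with rfl | hξ
    · simp [diffSymbol_zero_left hm]
    -- The constant is nonzero, for otherwise the normalization identity would give $|\xi|^{2s}=0$.
    · refine inv_mul_cancel_left₀ (fun h => ?_) _
      have h1 := normConst_mul_integral_diffSymbol_div hm hs0 hs ξ
      rw [h, zero_mul] at h1
      exact (Real.rpow_pos_of_pos (norm_pos_iff.2 hξ) (2 * s)).ne h1

theorem integrand_eq_integral (hu : ContDiff ℝ ∞ u) (hc : HasCompactSupport u)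
    (x y : Space N) :
    integrand m s u x y = (((2 * Real.pi) ^ (-((N : ℝ) / 2)) : ℝ) : ℂ) *
      ∫ ξ, Complex.exp (Complex.I * ((inner ℝ x ξ : ℝ) : ℂ)) *
        (((diffSymbol m ξ y / ‖y‖ ^ ((N : ℝ) + 2 * s) : ℝ) : ℂ) * fourierF u ξ) := by
  rw [integrand, finDiff_eq_integral m hu hc, mul_div_assoc, ← integral_div]
  congr 1
  refine integral_congr_ae (Eventually.of_forall fun ξ => ?_)
  simp only
  push_cast
  ring

theorem integrable_integrand (hm : 1 ≤ m) (hu : ContDiff ℝ ∞ u) (hc : HasCompactSupport u)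
    (hs0 : 0 < s) (hs : s < m) (x : Space N) : Integrable (integrand m s u x) := by
  have h := (integrable_prod_symbol hm hu hc hs0 hs x).integral_prod_left
  refine (h.const_mul (((2 * Real.pi) ^ (-((N : ℝ) / 2)) : ℝ) : ℂ)).congr
    (Eventually.of_forall fun y => ?_)
  exact (integrand_eq_integral hu hc x y).symm

theorem hyperL_eq_fourierFInv (hm : 1 ≤ m) (hu : ContDiff ℝ ∞ u) (hc : HasCompactSupport u)
    (hs0 : 0 < s) (hs : s < m) (x : Space N) :
    hyperL m s u x = fourierFInv (symbolMul s u) x := by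
  simp only [hyperL, integrand_eq_integral hu hc]
  rw [integral_const_mul, integral_integral_swap (integrable_prod_symbol hm hu hc hs0 hs x),
    fourierFInv, mul_left_comm, ← integral_const_mul]
  congr 1
  refine integral_congr_ae (Eventually.of_forall fun ξ => ?_)
  simp only
  rw [integral_const_mul, integral_mul_const, integral_complex_ofReal, symbolMul,
    ← normConst_mul_integral_diffSymbol_div hm hs0 hs ξ, Complex.ofReal_mul]
  ring

end Fubini

/-! ### Square integrability of the hypersingular integral. -/

theorem integrable_min_one_norm_pow_div (hN : 1 ≤ N) {m : ℕ} {s : ℝ} (hs0 : 0 < s) (hs : s < m) :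
    Integrable fun y : Space N => min 1 (‖y‖ ^ (2 * m)) / ‖y‖ ^ ((N : ℝ) + 2 * s) := by
  have : Nonempty (Fin N) := ⟨⟨0, hN⟩⟩
  rw [integrable_fun_norm_addHaar (volume : Measure (Space N))
    (f := fun r : ℝ => min 1 (r ^ (2 * m)) / r ^ ((N : ℝ) + 2 * s)), finrank_euclideanSpace_fin]
  have hcont : Continuous fun r : ℝ => min 1 (r ^ (2 * m)) := by fun_prop
  -- In polar coordinates the integrand is $r^{-2s-1}\min(1,r^{2m})$: a Mellin integral at $-2s$,
  -- convergent as $0<2s<2m$.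
  have h := mellin_convergent_of_isBigO_scalar (a := 0) (b := -((2 * m : ℕ) : ℝ)) (s := -(2 * s))
    (hcont.locallyIntegrable.locallyIntegrableOn (Ioi 0)) ?_ (by linarith) ?_
    (by push_cast; linarith)
  · refine IntegrableOn.congr_fun h (fun r hr => ?_) measurableSet_Ioi
    have hr : 0 < r := hr
    have h1 : r ^ (-(2 * s) - 1) = r ^ (N - 1) / r ^ ((N : ℝ) + 2 * s) := by
      rw [← Real.rpow_natCast, Nat.cast_sub hN, ← Real.rpow_sub hr]
      congr 1
      push_cast
      ring
    rw [h1, smul_eq_mul]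
    ring
  · refine IsBigO.of_bound 1 (Eventually.of_forall fun r => ?_)
    have h0 : 0 ≤ r ^ (2 * m) := by rw [pow_mul]; positivity
    rw [Real.norm_of_nonneg (le_min zero_le_one h0)]
    simp
  · refine IsBigO.of_bound 1 (Eventually.of_forall fun r => ?_)
    have h0 : 0 ≤ r ^ (2 * m) := by rw [pow_mul]; positivity
    rw [Real.norm_of_nonneg (le_min zero_le_one h0), neg_neg, Real.rpow_natCast,
      Real.norm_of_nonneg h0, one_mul]
    exact min_le_right _ _

theorem diffSymbol_le (m : ℕ) (ξ y : Space N) :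
    diffSymbol m ξ y ≤ ‖y‖ ^ (2 * m) * ‖ξ‖ ^ (2 * m) := by
  have h1 : 2 - 2 * Real.cos (inner ℝ y ξ) ≤ (‖y‖ * ‖ξ‖) ^ 2 := by
    have h2 := Real.one_sub_sq_div_two_le_cos (x := inner ℝ y ξ)
    have h3 : (inner ℝ y ξ : ℝ) ^ 2 ≤ (‖y‖ * ‖ξ‖) ^ 2 :=
      sq_le_sq' (by linarith [neg_le_of_abs_le (abs_real_inner_le_norm y ξ)])
        (real_inner_le_norm y ξ)
    linarith
  rw [← mul_pow, pow_mul]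
  exact pow_le_pow_left₀ (by linarith [Real.cos_le_one (inner ℝ y ξ)]) h1 m

section finDiff

variable {u : Space N → ℂ}

/-- The symbol is at most $|y|^{2m}|\xi|^{2m}$, and $\mathcal F u$ has a finite absolute moment of
order $2m$. -/
theorem exists_norm_finDiff_le (m : ℕ) (hu : ContDiff ℝ ∞ u) (hc : HasCompactSupport u) :
    ∃ C, 0 ≤ C ∧ ∀ x y, ‖finDiff m u x y‖ ≤ C * ‖y‖ ^ (2 * m) := by
  obtain ⟨γ, hγ⟩ := exists_schwartz_fourierF hu hc
  refine ⟨(2 * Real.pi) ^ (-((N : ℝ) / 2)) * ∫ ξ, ‖ξ‖ ^ (2 * m) * ‖γ ξ‖, by positivity,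
    fun x y => ?_⟩
  rw [finDiff_eq_integral m hu hc, hγ, norm_mul, Complex.norm_real,
    Real.norm_of_nonneg (by positivity), mul_assoc]
  refine mul_le_mul_of_nonneg_left ?_ (by positivity)
  rw [← integral_mul_const]
  refine norm_integral_le_of_norm_le ((γ.integrable_pow_mul volume (2 * m)).mul_const _)
    (Eventually.of_forall fun ξ => ?_)
  rw [norm_mul, norm_cexp_I_mul_ofReal, one_mul, norm_mul, Complex.norm_real,
    Real.norm_of_nonneg (diffSymbol_nonneg _ _ _)]
  refine (mul_le_mul_of_nonneg_right (diffSymbol_le m ξ y) (norm_nonneg _)).trans_eq ?_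
  ring

theorem continuous_finDiff_uncurry (m : ℕ) (hu : Continuous u) :
    Continuous fun q : Space N × Space N => finDiff m u q.1 q.2 := by
  unfold finDiff
  fun_prop

theorem integrable_finDiff_left (m : ℕ) (hu : Integrable u) (y : Space N) :
    Integrable fun x => finDiff m u x y := by
  unfold finDiff
  exact integrable_finsetSum _ fun k _ => (hu.comp_add_right _).const_mul _

theorem integral_norm_finDiff_le (m : ℕ) (hu : Integrable u) (y : Space N) :
    ∫ x, ‖finDiff m u x y‖ ≤
      (∑ k ∈ Finset.Icc (-(m : ℤ)) m, |diffWeight m k|) * ∫ x, ‖u x‖ := by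
  have hk : ∀ k : ℤ, Integrable fun x => |diffWeight m k| * ‖u (x + (k : ℝ) • y)‖ :=
    fun k => (hu.comp_add_right _).norm.const_mul _
  calc ∫ x, ‖finDiff m u x y‖
      ≤ ∫ x, ∑ k ∈ Finset.Icc (-(m : ℤ)) m, |diffWeight m k| * ‖u (x + (k : ℝ) • y)‖ := by
        refine integral_mono (integrable_finDiff_left m hu y).norm
          (integrable_finsetSum _ fun k _ => hk k) fun x => ?_
        refine (norm_sum_le _ _).trans_eq (Finset.sum_congr rfl fun k _ => ?_)
        simp [diffWeight, abs_mul]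
    _ = _ := by
        rw [integral_finsetSum _ fun k _ => hk k, Finset.sum_mul]
        refine Finset.sum_congr rfl fun k _ => ?_
        rw [integral_const_mul, integral_add_right_eq_self (fun x => ‖u x‖)]

theorem finDiff_eq_zero_of_lt_norm (m : ℕ) {R : ℝ} (hR : ∀ x, u x ≠ 0 → ‖x‖ ≤ R) {x y : Space N}
    (hy : ‖y‖ ≤ 1) (hx : R + m < ‖x‖) : finDiff m u x y = 0 := by
  refine Finset.sum_eq_zero fun k hk => ?_
  have hux : u (x + (k : ℝ) • y) = 0 := by
    by_contra hne
    have h1 := hR _ hne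
    have hk' : |(k : ℝ)| ≤ m := by
      rw [Finset.mem_Icc] at hk
      rw [abs_le]
      exact ⟨by exact_mod_cast hk.1, by exact_mod_cast hk.2⟩
    have h2 : ‖(k : ℝ) • y‖ ≤ m := by
      rw [norm_smul, Real.norm_eq_abs]
      exact (mul_le_mul hk' hy (norm_nonneg _) m.cast_nonneg).trans_eq (mul_one _)
    have h3 : ‖x‖ ≤ ‖x + (k : ℝ) • y‖ + ‖(k : ℝ) • y‖ := by
      simpa using norm_sub_le (x + (k : ℝ) • y) ((k : ℝ) • y)
    linarith
  rw [hux, mul_zero]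

/-- For $|y|\le1$ the difference lives in a fixed ball, where the pointwise $|y|^{2m}$ bound is
integrated; for $|y|\ge1$ translation invariance suffices. -/
theorem exists_integral_norm_finDiff_le (m : ℕ) (hu : ContDiff ℝ ∞ u)
    (hc : HasCompactSupport u) :
    ∃ B, ∀ y, ∫ x, ‖finDiff m u x y‖ ≤ B * min 1 (‖y‖ ^ (2 * m)) := by
  have hui : Integrable u := (hc.toSchwartzMap hu).integrable
  obtain ⟨C, hC0, hC⟩ := exists_norm_finDiff_le m hu hc
  obtain ⟨R, hR⟩ : ∃ R, ∀ x, u x ≠ 0 → ‖x‖ ≤ R := by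
    obtain ⟨R, hR⟩ := hc.isBounded.exists_norm_le
    exact ⟨R, fun x hx => hR x (subset_tsupport u hx)⟩
  set A := (∑ k ∈ Finset.Icc (-(m : ℤ)) m, |diffWeight m k|) * ∫ x, ‖u x‖
  have hA : 0 ≤ A := by positivity
  set V := (volume : Measure (Space N)).real (Metric.closedBall 0 (R + m))
  have hV : 0 ≤ V := measureReal_nonneg
  refine ⟨A + C * V, fun y => ?_⟩
  rcases le_total ‖y‖ 1 with hy | hy
  · rw [min_eq_right (pow_le_one₀ (norm_nonneg _) hy)]
    have h1 : ∫ x, ‖finDiff m u x y‖ ≤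
        ∫ x in Metric.closedBall (0 : Space N) (R + m), C * ‖y‖ ^ (2 * m) := by
      rw [← integral_indicator Metric.isClosed_closedBall.measurableSet]
      refine integral_mono (integrable_finDiff_left m hui y).norm ?_ fun x => ?_
      · rw [integrable_indicator_iff Metric.isClosed_closedBall.measurableSet]
        exact integrableOn_const (isCompact_closedBall _ _).measure_lt_top.ne
      · by_cases hx : x ∈ Metric.closedBall (0 : Space N) (R + m)
        · rw [indicator_of_mem hx]
          exact hC x y
        · rw [indicator_of_notMem hx, finDiff_eq_zero_of_lt_norm m hR hy (by simpa using hx),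
            norm_zero]
    rw [setIntegral_const, smul_eq_mul] at h1
    refine h1.trans ?_
    have : 0 ≤ A * ‖y‖ ^ (2 * m) := by positivity
    calc V * (C * ‖y‖ ^ (2 * m)) ≤ V * (C * ‖y‖ ^ (2 * m)) + A * ‖y‖ ^ (2 * m) := by linarith
      _ = _ := by ring
  · rw [min_eq_left (one_le_pow₀ hy), mul_one]
    have := integral_norm_finDiff_le m hui y
    have : 0 ≤ C * V := by positivity
    linarith

end finDiff

section hyperL

variable {m : ℕ} {s : ℝ} {u : Space N → ℂ}

/-- Fubini in $(x,y)$, taking the integral in `x` first so that the compact support of `u` gives the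
$\min(1,|y|^{2m})$ bound. -/
theorem integrable_hyperL (hN : 1 ≤ N) (hu : ContDiff ℝ ∞ u) (hc : HasCompactSupport u)
    (hs0 : 0 < s) (hs : s < m) : Integrable (hyperL m s u) := by
  have hui : Integrable u := (hc.toSchwartzMap hu).integrable
  obtain ⟨B, hB⟩ := exists_integral_norm_finDiff_le m hu hc
  have hmeas : Measurable (Function.uncurry (integrand m s u)) := by
    have h2 : Measurable fun q : Space N × Space N => ‖q.2‖ ^ ((N : ℝ) + 2 * s) := by fun_prop
    exact (continuous_finDiff_uncurry m hu.continuous).measurable.div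
      (Complex.measurable_ofReal.comp h2)
  have hnorm : ∀ x y, ‖integrand m s u x y‖ =
      ‖finDiff m u x y‖ / ‖y‖ ^ ((N : ℝ) + 2 * s) := by
    intro x y
    rw [integrand, norm_div, Complex.norm_real, Real.norm_of_nonneg (by positivity)]
  have hint : Integrable (Function.uncurry (integrand m s u)) (volume.prod volume) := by
    rw [integrable_prod_iff' hmeas.aestronglyMeasurable]
    refine ⟨Eventually.of_forall fun y => ?_, ?_⟩
    · simp only [Function.uncurry_apply_pair, integrand]
      exact (integrable_finDiff_left m hui y).div_const _
    refine ((integrable_min_one_norm_pow_div hN hs0 hs).const_mul B).mono'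
      hmeas.stronglyMeasurable.norm.integral_prod_left'.aestronglyMeasurable
      (Eventually.of_forall fun y => ?_)
    simp only [Function.uncurry_apply_pair, hnorm]
    rw [integral_div, Real.norm_of_nonneg (by positivity), ← mul_div_assoc]
    exact div_le_div_of_nonneg_right (hB y) (by positivity)
  exact hint.integral_prod_left.const_mul _

theorem norm_fourierFInv_le (g : Space N → ℂ) (x : Space N) :
    ‖fourierFInv g x‖ ≤ (2 * Real.pi) ^ (-((N : ℝ) / 2)) * ∫ ξ, ‖g ξ‖ := by
  rw [fourierFInv, norm_mul, Complex.norm_real, Real.norm_of_nonneg (by positivity)]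
  refine mul_le_mul_of_nonneg_left ((norm_integral_le_integral_norm _).trans_eq ?_) (by positivity)
  simp only [norm_mul, norm_cexp_I_mul_ofReal, one_mul]

theorem memLp_two_hyperL (hN : 1 ≤ N) (hm : 1 ≤ m) (hu : ContDiff ℝ ∞ u)
    (hc : HasCompactSupport u) (hs0 : 0 < s) (hs : s < m) : MemLp (hyperL m s u) 2 :=
  memLp_two_of_integrable_of_bound (integrable_hyperL hN hu hc hs0 hs) fun x => by
    rw [hyperL_eq_fourierFInv hm hu hc hs0 hs x]
    exact norm_fourierFInv_le _ x

end hyperL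

end Hypersingular

/-- `L_{m,s}` is well defined as a map from `C_c^∞(ℝ^N)` to `L²(ℝ^N)` (its defining integral
converges absolutely at every point), the function `|·|^{2s} F u` lies in `L¹ ∩ L²`, so that its
inverse Fourier transform is given by an absolutely convergent integral, and
`L_{m,s} u = F⁻¹(|·|^{2s} F u)` at every point. -/
theorem theorem1p6 (N m : ℕ) (hN : 1 ≤ N) (hm : 1 ≤ m) (s : ℝ) (hs : s ∈ Set.Ioo (0 : ℝ) (m : ℝ))
    (u : Hypersingular.Space N → ℂ) (hu : ContDiff ℝ ∞ u) (hc : HasCompactSupport u) :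
    (∀ x, MeasureTheory.Integrable (Hypersingular.integrand m s u x) MeasureTheory.volume) ∧
    MeasureTheory.MemLp (Hypersingular.hyperL m s u) 2 MeasureTheory.volume ∧
    MeasureTheory.MemLp (Hypersingular.symbolMul s u) 1 MeasureTheory.volume ∧
    MeasureTheory.MemLp (Hypersingular.symbolMul s u) 2 MeasureTheory.volume ∧
    (∀ x, Hypersingular.hyperL m s u x =
      Hypersingular.fourierFInv (Hypersingular.symbolMul s u) x) :=
  ⟨fun x => Hypersingular.integrable_integrand hm hu hc hs.1 hs.2 x,
    Hypersingular.memLp_two_hyperL hN hm hu hc hs.1 hs.2,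
    MeasureTheory.memLp_one_iff_integrable.2 (Hypersingular.integrable_symbolMul hu hc hs.1 hs.2),
    Hypersingular.memLp_two_symbolMul hu hc hs.1 hs.2,
    fun x => Hypersingular.hyperL_eq_fourierFInv hm hu hc hs.1 hs.2 x⟩
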